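/- Let $\Sigma$ and $S$ be compact metrizable spaces with countable bases, let $\Sigma$ be a topological semigroup (jointly continuous product) acting on $S$ by a jointly continuous map $(\sigma,x)\mapsto\sigma x$ with $\sigma_1(\sigma_2x)=(\sigma_1\sigma_2)x$ (if $\Sigma$ has an identity, it is not assumed to act as the identity). Let $-\mathbb N=\{0,-1,-2,\dots\}$ and let $\mu=(\mu_k)_{k\in-\mathbb N}$ be Borel probability measures on $\Sigma$. A solution with noise law $\mu$ is a pair $\{X,N\}$ of processes $(X_k)_{k\in-\mathbb N}$ in $S$ and $(N_k)_{k\in-\mathbb N}$ in $\Sigma$ on a common probability space such that, for every $k\in-\mathbb N$: $X_k=N_kX_{k-1}$ a.s.; $N_k$ is independent of $\sigma(X_j,N_j:j\le k-1)$; and $N_k$ has law $\mu_k$. A solution is extremal if its law on $S^{-\mathbb N}\times\Sigma^{-\mathbb N}$ is an extreme point of the convex set of the laws of all solutions with noise law $\mu$. It is strong if for every $k\in-\mathbb N$ there is a measurable function $f_k:\Sigma^{-\mathbb N}\to S$ with $X_k=f_k(N_k,N_{k-1},\dots)$ a.s. Write $N_{k,l}=N_kN_{k-1}\cdots N_{l+1}$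 for $k>l$. Let $\{X,N\}$ be an extremal solution with noise law $\mu$. Assume condition (P2$'$): $H\subset\Sigma$ is a compact non-trivial subgroup (a set with at least two elements, closed under the product and a group for it) such that, for every $k\in-\mathbb N$, $N_{k,l}$ converges in law as $l\to-\infty$ to a law $\rho$ that is right $H$-invariant (if $Z$ has law $\rho$, so has $Zh$, for every $h\in H$), and the random coset $N_{k,l}H$ converges a.s. as $l\to-\infty$ in the space $\Sigma/H=\{\sigma H:\sigma\in\Sigma\}$ with the quotient topology. Let $\nu_k=\lim_{l\to-\infty}\mu_k*\mu_{k-1}*\cdots*\mu_{l+1}$ (weak limit), and let $x\in S$ be such that, for every $k\in-\mathbb N$, the law $\lambda_k$ of $X_k$ is $\lambda_k=\nu_k*\delta_x$, that is, the law of $Z_kx$ when $Z_k$ has law $\nu_k$. Suppose moreover that $\Sigma$ is left-cancellative ($\sigma\sigma_1=\sigma\sigma_2$ implies $\sigma_1=\sigma_2$), that every $\sigma\in\Sigma$ has cancellative action on $S$ ($\sigma y=\sigma z$ implies $y=z$ for $y,z\in S$), and that $Hx=\{hx:h\in H\}$ is not a singleton. Then the solution $\{X,N\}$ is not strong. -/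

import Mathlib

open MeasureTheory ProbabilityTheory Filter Topology
open scoped NNReal

namespace Tsirelson

/-! Time runs through the non-positive integers.  A sequence indexed by `n : ℕ` carries at `n` the
object of time `-n`; thus `X (n + 1)` is the state one step before `X n`. -/

section Algebra

variable {T S : Type*} [Semigroup T] [SemigroupAction T S]

/-- `H` is a subgroup of the semigroup `T`: closed under the product of `T` and a group for it.
The identity of `H` need not be an identity of `T`. -/
structure IsSubgroupOf (H : Set T) : Prop where
  mul_mem : ∀ a ∈ H, ∀ b ∈ H, a * b ∈ H
  exists_one_inv : ∃ e ∈ H, (∀ a ∈ H, e * a = a ∧ a * e = a) ∧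
    ∀ a ∈ H, ∃ b ∈ H, a * b = e ∧ b * a = e

/-- The left coset `σ H`. -/
def leftCoset (H : Set T) (σ : T) : Set T := (fun h => σ * h) '' H

/-- Two elements are identified when their left cosets by `H` agree. -/
def cosetSetoid (H : Set T) : Setoid T := Setoid.ker (leftCoset H)

/-- The space `T / H` of left cosets; it carries the quotient topology. -/
abbrev CosetSpace (H : Set T) : Type _ := Quotient (cosetSetoid H)

/-- The projection `σ ↦ σ H` of `T` onto `T / H`. -/
def toCoset (H : Set T) (σ : T) : CosetSpace H := Quotient.mk (cosetSetoid H) σ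

/-- The orbit `H x = {h x : h ∈ H}`. -/
def orbitOf (H : Set T) (x : S) : Set S := (fun h : T => h • x) '' H

/-- `σ` has cancellative action on `S`. -/
def HasCancellativeAction (S : Type*) [SemigroupAction T S] (σ : T) : Prop :=
  ∀ x y : S, σ • x = σ • y → x = y

/-- The noise product `N_k N_{k-1} ⋯ N_{l+1}`: in terms of `ℕ`, the product
`N k * N (k + 1) * ⋯ * N (k + n)`. -/
def noiseProd {Ω : Type*} (N : ℕ → Ω → T) (k : ℕ) : ℕ → Ω → T
  | 0 => N k
  | n + 1 => fun ω => noiseProd N k n ω * N (k + n + 1) ω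

end Algebra

section Convolution

variable {T : Type*} [TopologicalSpace T] [SecondCountableTopology T]
  [MeasurableSpace T] [BorelSpace T] [Semigroup T] [ContinuousMul T]

/-- The convolution `μ * ν` of two laws on the semigroup. -/
noncomputable def conv (μ ν : ProbabilityMeasure T) : ProbabilityMeasure T :=
  (μ.prod ν).map (f := fun p : T × T => p.1 * p.2) (by fun_prop)

/-- The iterated convolution `μ k * μ (k + 1) * ⋯ * μ (k + n)`. -/
noncomputable def convProd (μ : ℕ → ProbabilityMeasure T) (k : ℕ) : ℕ → ProbabilityMeasure T
  | 0 => μ k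
  | n + 1 => conv (convProd μ k n) (μ (k + n + 1))

/-- The convolution `ν * lam` of a law on the semigroup with a law on the space it acts on. -/
noncomputable def actConv {S : Type*} [TopologicalSpace S] [SecondCountableTopology S]
    [MeasurableSpace S] [BorelSpace S] [SemigroupAction T S] [ContinuousSMul T S]
    (ν : ProbabilityMeasure T) (lam : ProbabilityMeasure S) : ProbabilityMeasure S :=
  (ν.prod lam).map (f := fun p : T × S => p.1 • p.2) (by fun_prop)

end Convolution

section Solutions

variable {T S Ω : Type*} [MeasurableSpace T] [Semigroup T] [MeasurableSpace S]
  [SemigroupAction T S] [MeasurableSpace Ω]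

/-- `(X, N)` is, under `P`, a solution of Tsirelson's equation `X_k = N_k X_{k-1}` with noise law
`μ`.  Independence is from the whole past `(X_j, N_j)`, `j ≤ k - 1`, as a random sequence. -/
structure IsSolution (μ : ℕ → ProbabilityMeasure T) (P : Measure Ω)
    (X : ℕ → Ω → S) (N : ℕ → Ω → T) : Prop where
  measurable_X : ∀ k, Measurable (X k)
  measurable_N : ∀ k, Measurable (N k)
  equation : ∀ k, ∀ᵐ ω ∂P, X k ω = N k ω • X (k + 1) ω
  indep_past : ∀ k,
    IndepFun (N k) (fun ω (j : ℕ) => (X (k + 1 + j) ω, N (k + 1 + j) ω)) P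
  law_N : ∀ k, P.map (N k) = (μ k : Measure T)

/-- The law of `(X, N)` on the path space. -/
noncomputable def pathLaw (P : Measure Ω) (X : ℕ → Ω → S) (N : ℕ → Ω → T) :
    Measure ((ℕ → S) × (ℕ → T)) :=
  P.map (fun ω => (fun k => X k ω, fun k => N k ω))

/-- The set of the laws of all solutions with noise law `μ`, on the path space: the probability
measures under which the coordinate processes form a solution. -/
def solutionLaws (S : Type*) [MeasurableSpace S] [SemigroupAction T S]
    (μ : ℕ → ProbabilityMeasure T) : Set (Measure ((ℕ → S) × (ℕ → T))) :=
  {L | IsProbabilityMeasure L ∧ IsSolution μ L (fun k p => p.1 k) (fun k p => p.2 k)}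

/-- An extremal solution: its law is an extreme point of the convex set of laws of solutions. -/
def IsExtremalSolution (μ : ℕ → ProbabilityMeasure T) (P : Measure Ω)
    (X : ℕ → Ω → S) (N : ℕ → Ω → T) : Prop :=
  IsSolution μ P X N ∧ pathLaw P X N ∈ Set.extremePoints ℝ≥0 (solutionLaws S μ)

/-- A strong process: each state is a measurable function of the present and past noise. -/
def IsStrong (P : Measure Ω) (X : ℕ → Ω → S) (N : ℕ → Ω → T) : Prop :=
  ∀ k, ∃ f : (ℕ → T) → S, Measurable f ∧ ∀ᵐ ω ∂P, X k ω = f (fun j => N (k + j) ω)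

end Solutions

/-- The noise `N` satisfies condition (P2') with the subgroup `H`: `H` is a compact non-trivial
subgroup; for every `k` the products `N_{k,l}` converge in law, as `l → -∞`, to a right
`H`-invariant law; and the cosets `N_{k,l} H` converge almost surely in `T / H`. -/
structure ConditionP2' {T Ω : Type*} [TopologicalSpace T] [MeasurableSpace T] [BorelSpace T]
    [Semigroup T] [MeasurableSpace Ω] (P : Measure Ω) [IsProbabilityMeasure P]
    (N : ℕ → Ω → T) (H : Set T) : Prop where
  isSubgroup : IsSubgroupOf H
  isCompact : IsCompact H
  nontrivial : H.Nontrivial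
  tendsto_law : ∀ k, ∃ ρ : ProbabilityMeasure T,
    TendstoInDistribution (noiseProd N k) atTop (id : T → T) (fun _ => P) (ρ : Measure T) ∧
    ∀ h ∈ H, (ρ : Measure T).map (fun σ => σ * h) = (ρ : Measure T)
  tendsto_coset : ∀ k, ∀ᵐ ω ∂P, ∃ c : CosetSpace H,
    Tendsto (fun n => toCoset H (noiseProd N k n ω)) atTop (𝓝 c)

end Tsirelson

/-! Suppose the solution is strong. Let `Z` have law `ν (k + n + 1)` and be independent of the
noise. Since `ν` is right `H`-invariant, `Z • x` and `Z • (b • x)`, with `b ∈ H`, both have the law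
of `X (k + n + 1)`. This state is independent of the noise from `k` to `k + n`, so either one may
replace it without changing the joint law of that noise block and `X k`.

Now `X k`, being a function of the noise, is approximated in mean by a function `φ` of a finite
block. Both `(noiseProd N k n * Z) • x` and `(noiseProd N k n * Z) • (b • x)` are then as close to
`φ` as `X k` is, hence close to each other. As `noiseProd N k n * Z` has law `ν k` for every `n`,
their mean distance does not depend on `n`, so it vanishes: `σ • x = σ • b • x` for `ν k`-almost
every `σ`. Cancelling one such `σ` makes `H x` a singleton (`IsSolution.lintegral_edist_smul_le`,
`IsSolution.ae_smul_eq_of_isStrong`). -/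

namespace Tsirelson

/-! ### Regrouping independent variables -/

section Independence

variable {Ω α β γ : Type*} [MeasurableSpace Ω] [MeasurableSpace α] [MeasurableSpace β]
  [MeasurableSpace γ] {P : Measure Ω} [IsProbabilityMeasure P]

/-- If `f` is independent of `(g, h)` and `g` of `h`, then `(f, g)` is independent of `h`. -/
theorem indepFun_prodMk_left {f : Ω → α} {g : Ω → β} {h : Ω → γ} (hf : Measurable f)
    (hg : Measurable g) (hh : Measurable h) (h₁ : IndepFun f (fun ω => (g ω, h ω)) P)
    (h₂ : IndepFun g h P) : IndepFun (fun ω => (f ω, g ω)) h P := by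
  have : IsProbabilityMeasure (P.map f) := Measure.isProbabilityMeasure_map hf.aemeasurable
  have : IsProbabilityMeasure (P.map g) := Measure.isProbabilityMeasure_map hg.aemeasurable
  have : IsProbabilityMeasure (P.map h) := Measure.isProbabilityMeasure_map hh.aemeasurable
  have hfg : IndepFun f g P := h₁.comp measurable_id measurable_fst
  rw [indepFun_iff_map_prod_eq_prod_map_map (by fun_prop) (by fun_prop)] at h₁ h₂ hfg ⊢
  -- Once reassociated, both sides are the product of the three marginal laws.
  rw [hfg, ← (MeasurableEquiv.prodAssoc (α := α) (β := β) (γ := γ)).map_measurableEquiv_injective.eq_iff]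
  change _ = Measure.map (MeasurableEquiv.prodAssoc (α := α) (β := β) (γ := γ)) _
  rw [Measure.prodAssoc_prod, Measure.map_map (MeasurableEquiv.measurable _) (by fun_prop), ← h₂,
    ← h₁]
  rfl

end Independence

/-! ### Independence of a finite noise block from the earlier past -/

section Noise

variable {T S Ω : Type*} [MeasurableSpace T] [Semigroup T] [MeasurableSpace S]
  [SemigroupAction T S] [MeasurableSpace Ω]

/-- The noise from time `k` down to time `k + n`. -/
def noiseBlock (N : ℕ → Ω → T) (k n : ℕ) (ω : Ω) (j : Set.Iic n) : T := N (k + j) ω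

/-- The states and the noise from time `k` on into the past. -/
def past (X : ℕ → Ω → S) (N : ℕ → Ω → T) (k : ℕ) (ω : Ω) (j : ℕ) : S × T :=
  (X (k + j) ω, N (k + j) ω)

/-- The `σ`-algebras generated by the noise from time `k` down to time `k + n`. -/
def noiseFiltration (N : ℕ → Ω → T) (hN : ∀ j, Measurable (N j)) (k : ℕ) :
    Filtration ℕ ‹MeasurableSpace Ω› where
  seq n := MeasurableSpace.comap (noiseBlock N k n) inferInstance
  mono' m n hmn := by
    have : noiseBlock N k m = (fun (p : Set.Iic n → T) (j : Set.Iic m) =>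
        p ⟨j, le_trans j.2 hmn⟩) ∘ noiseBlock N k n := rfl
    change MeasurableSpace.comap (noiseBlock N k m) _ ≤ _
    rw [this, ← MeasurableSpace.comap_comp]
    exact MeasurableSpace.comap_mono (measurable_iff_comap_le.1 (by fun_prop))
  le' n := measurable_iff_comap_le.1 (measurable_pi_iff.2 fun j => hN _)

omit [Semigroup T] in
theorem measurable_noise_noiseFiltration {N : ℕ → Ω → T} (hN : ∀ j, Measurable (N j)) (k : ℕ)
    {j n : ℕ} (hj : j ≤ n) : Measurable[noiseFiltration N hN k n] (N (k + j)) := by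
  have h : Measurable[noiseFiltration N hN k n] (noiseBlock N k n) :=
    comap_measurable (noiseBlock N k n)
  exact (measurable_pi_apply (⟨j, hj⟩ : Set.Iic n)).comp h

theorem measurable_noiseProd_noiseFiltration [MeasurableMul₂ T] {N : ℕ → Ω → T}
    (hN : ∀ j, Measurable (N j)) (k : ℕ) {m n : ℕ} (h : m ≤ n) :
    Measurable[noiseFiltration N hN k n] (noiseProd N k m) := by
  induction m with
  | zero => exact measurable_noise_noiseFiltration hN k (Nat.zero_le n)
  | succ m ih =>
    exact (ih (Nat.le_of_succ_le h)).mul (measurable_noise_noiseFiltration hN k h)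

variable {μ : ℕ → ProbabilityMeasure T} {P : Measure Ω} [IsProbabilityMeasure P]
  {X : ℕ → Ω → S} {N : ℕ → Ω → T}

omit [IsProbabilityMeasure P] in
theorem IsSolution.measurable_past (h : IsSolution μ P X N) (k : ℕ) :
    Measurable (past X N k) :=
  measurable_pi_iff.2 fun _ => (h.measurable_X _).prodMk (h.measurable_N _)

/-- One noise variable at a time moves from the past into the block; `indep_past` makes it
independent of what remains. -/
theorem IsSolution.indepFun_noiseBlock_past (h : IsSolution μ P X N) (k n : ℕ) :
    IndepFun (noiseBlock N k n) (past X N (k + n + 1)) P := by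
  induction n with
  | zero =>
    refine (h.indep_past k).comp (φ := fun t (_ : Set.Iic 0) => t) (by fun_prop) measurable_id
      |>.congr (.of_forall fun ω => ?_) (.of_forall fun ω => rfl)
    funext ⟨j, hj⟩
    obtain rfl : j = 0 := Nat.le_zero.1 hj
    rfl
  | succ n ih =>
    -- Keep only the newest noise and everything strictly before it; the state at time `k + n + 1`
    -- is dropped.
    have h₁ : IndepFun (noiseBlock N k n)
        (fun ω => (N (k + n + 1) ω, past X N (k + n + 1 + 1) ω)) P := by
      refine ih.comp (ψ := fun p : ℕ → S × T => ((p 0).2, fun j => p (j + 1))) measurable_id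
        (by fun_prop) |>.congr (.of_forall fun ω => rfl) (.of_forall fun ω => ?_)
      simp only [Function.comp, past, add_zero, Prod.mk.injEq, true_and]
      funext j
      rw [show k + n + 1 + (j + 1) = k + n + 1 + 1 + j by omega]
      rfl
    have h₂ := indepFun_prodMk_left (measurable_pi_iff.2 fun j => h.measurable_N _)
      (h.measurable_N _) (h.measurable_past _) h₁ (h.indep_past (k + n + 1))
    refine h₂.comp (φ := fun (p : (Set.Iic n → T) × T) (j : Set.Iic (n + 1)) =>
      if hj : (j : ℕ) ≤ n then p.1 ⟨j, hj⟩ else p.2) (measurable_pi_iff.2 fun j => ?_)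
      measurable_id |>.congr (.of_forall fun ω => ?_) (.of_forall fun ω => rfl)
    · split_ifs <;> fun_prop
    · funext ⟨j, hj⟩
      by_cases hjn : j ≤ n
      · simp [noiseBlock, hjn]
      · obtain rfl : j = n + 1 := le_antisymm hj (by omega)
        simp [noiseBlock, add_assoc]

/-- What is determined by the noise at the times `k, …, k + n` is independent of the past before. -/
theorem IsSolution.indepFun_of_measurable_noiseFiltration {α : Type*} [MeasurableSpace α]
    (h : IsSolution μ P X N) (k n : ℕ) {W : Ω → α}
    (hW : Measurable[noiseFiltration N h.measurable_N k n] W) :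
    IndepFun W (past X N (k + n + 1)) P := by
  have := h.indepFun_noiseBlock_past k n
  rw [IndepFun_iff_Indep] at this ⊢
  exact indep_of_indep_of_le_left this (measurable_iff_comap_le.1 hW)

end Noise

/-! ### Convolutions and their limits -/

section Laws

variable {T S Ω : Type*}
  [TopologicalSpace T] [SecondCountableTopology T] [MeasurableSpace T] [BorelSpace T]
  [Semigroup T] [ContinuousMul T]

theorem coe_conv (α β : ProbabilityMeasure T) :
    (conv α β : Measure T) = ((α : Measure T).prod β).map (fun p : T × T => p.1 * p.2) := rfl

theorem conv_assoc (α β γ : ProbabilityMeasure T) :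
    conv (conv α β) γ = conv α (conv β γ) := by
  apply Subtype.ext
  change (conv (conv α β) γ : Measure T) = (conv α (conv β γ) : Measure T)
  rw [coe_conv, coe_conv, coe_conv, coe_conv]
  have h₁ := Measure.map_prod_map ((α : Measure T).prod (β : Measure T)) (γ : Measure T)
    (f := fun p : T × T => p.1 * p.2) (g := id) (by fun_prop) measurable_id
  have h₂ := Measure.map_prod_map (α : Measure T) ((β : Measure T).prod (γ : Measure T))
    (f := id) (g := fun p : T × T => p.1 * p.2) measurable_id (by fun_prop)
  rw [Measure.map_id] at h₁ h₂
  rw [h₁, h₂, ← Measure.prodAssoc_prod, Measure.map_map (by fun_prop) (by fun_prop),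
    Measure.map_map (by fun_prop) (by fun_prop), Measure.map_map (by fun_prop) (by fun_prop)]
  congr 1
  funext p
  exact mul_assoc _ _ _

theorem continuous_conv_right [TopologicalSpace.PseudoMetrizableSpace T] (α : ProbabilityMeasure T) : Continuous (conv α) := by
  have h : Continuous fun β : ProbabilityMeasure T => α.prod β :=
    ProbabilityMeasure.continuous_prod.comp (continuous_const.prodMk continuous_id)
  exact (ProbabilityMeasure.continuous_map (f := fun p : T × T => p.1 * p.2) (by fun_prop)).comp h

theorem conv_convProd (μ : ℕ → ProbabilityMeasure T) (k n m : ℕ) :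
    conv (convProd μ k n) (convProd μ (k + n + 1) m) = convProd μ k (m + (n + 1)) := by
  induction m with
  | zero => rw [Nat.zero_add]; rfl
  | succ m ih =>
    rw [convProd, ← conv_assoc, ih, show m + 1 + (n + 1) = m + (n + 1) + 1 by omega, convProd,
      show k + n + 1 + m + 1 = k + (m + (n + 1)) + 1 by omega]

/-- Let the second factor of `conv_convProd` tend to its limit, by continuity of convolution. This
keeps the law of the noise product times an independent limit variable fixed as `n` varies. -/
theorem conv_convProd_limit [TopologicalSpace.PseudoMetrizableSpace T] {μ ν : ℕ → ProbabilityMeasure T}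
    (hν : ∀ k, Tendsto (convProd μ k) atTop (𝓝 (ν k))) (k n : ℕ) :
    conv (convProd μ k n) (ν (k + n + 1)) = ν k := by
  refine tendsto_nhds_unique (((continuous_conv_right (convProd μ k n)).tendsto _).comp
    (hν (k + n + 1))) (((tendsto_add_atTop_iff_nat (n + 1)).2 (hν k)).congr fun m => ?_)
  exact (conv_convProd μ k n m).symm

variable [MeasurableSpace S] [SemigroupAction T S] [MeasurableSpace Ω]
  {μ : ℕ → ProbabilityMeasure T} {P : Measure Ω} [IsProbabilityMeasure P]
  {X : ℕ → Ω → S} {N : ℕ → Ω → T}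

theorem IsSolution.map_noiseProd (h : IsSolution μ P X N) (k n : ℕ) :
    P.map (noiseProd N k n) = convProd μ k n := by
  induction n with
  | zero => exact h.law_N k
  | succ n ih =>
    have hm := measurable_noiseProd_noiseFiltration h.measurable_N k (le_refl n)
    have hm' : Measurable (noiseProd N k n) := hm.mono ((noiseFiltration N _ k).le n) le_rfl
    have hi : IndepFun (noiseProd N k n) (N (k + n + 1)) P :=
      (h.indepFun_of_measurable_noiseFiltration k n hm).comp (φ := id)
        (ψ := fun p : ℕ → S × T => (p 0).2) measurable_id (by fun_prop)
    rw [indepFun_iff_map_prod_eq_prod_map_map hm'.aemeasurable (h.measurable_N _).aemeasurable,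
      ih, h.law_N] at hi
    rw [convProd, coe_conv, ← hi, Measure.map_map (by fun_prop)
      (hm'.prodMk (h.measurable_N _))]
    rfl

end Laws

/-! ### Strong solutions and the points representing their laws -/

section Action

variable {T S Ω : Type*}
  [TopologicalSpace T] [SecondCountableTopology T] [MeasurableSpace T] [BorelSpace T]
  [Semigroup T] [ContinuousMul T]
  [TopologicalSpace S] [SecondCountableTopology S] [MeasurableSpace S] [BorelSpace S]
  [SemigroupAction T S] [ContinuousSMul T S] [MeasurableSpace Ω]
  {μ ν : ℕ → ProbabilityMeasure T} {P : Measure Ω} [IsProbabilityMeasure P]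
  {X : ℕ → Ω → S} {N : ℕ → Ω → T}

omit [ContinuousMul T] in
theorem coe_actConv_diracProba (ν : ProbabilityMeasure T) (x : S) :
    (actConv ν (diracProba x) : Measure S) = (ν : Measure T).map (fun σ => σ • x) := by
  change ((ν : Measure T).prod (Measure.dirac x)).map (fun p : T × S => p.1 • p.2) = _
  rw [Measure.prod_dirac, Measure.map_map (by fun_prop) (by fun_prop)]
  rfl

omit [TopologicalSpace T] [SecondCountableTopology T] [BorelSpace T] [ContinuousMul T]
  [TopologicalSpace S] [SecondCountableTopology S] [BorelSpace S] [ContinuousSMul T S]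
  [IsProbabilityMeasure P] in
theorem IsSolution.eq_noiseProd_smul (h : IsSolution μ P X N) (k n : ℕ) :
    ∀ᵐ ω ∂P, X k ω = noiseProd N k n ω • X (k + n + 1) ω := by
  induction n with
  | zero => exact h.equation k
  | succ n ih =>
    filter_upwards [ih, h.equation (k + n + 1)] with ω h₁ h₂
    rw [h₁, h₂]
    exact (mul_smul _ _ _).symm

/-- The distance of a function of the state to a function of the noise at the times `k, …, k + n`,
in terms of a point representing the law of the state at time `k + n + 1`. -/
theorem IsSolution.lintegral_edist (h : IsSolution μ P X N) (k n : ℕ) {g : S → ℝ}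
    (hg : Measurable g) {φ : Ω → ℝ} (hφ : Measurable[noiseFiltration N h.measurable_N k n] φ)
    {ν : Measure T} [IsProbabilityMeasure ν] {y : S}
    (hy : P.map (X (k + n + 1)) = ν.map (fun σ => σ • y)) :
    ∫⁻ ω, edist (g (X k ω)) (φ ω) ∂P =
      ∫⁻ p, edist (g ((p.1.1 * p.2) • y)) p.1.2
        ∂(P.map (fun ω => (noiseProd N k n ω, φ ω))).prod ν := by
  have hW := (measurable_noiseProd_noiseFiltration h.measurable_N k (le_refl n)).prodMk hφ
  have hW' := hW.mono ((noiseFiltration N _ k).le n) le_rfl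
  have : IsProbabilityMeasure (P.map fun ω => (noiseProd N k n ω, φ ω)) :=
    Measure.isProbabilityMeasure_map hW'.aemeasurable
  have hi : IndepFun (fun ω => (noiseProd N k n ω, φ ω)) (X (k + n + 1)) P :=
    (h.indepFun_of_measurable_noiseFiltration k n hW).comp (φ := id)
      (ψ := fun p : ℕ → S × T => (p 0).1) measurable_id (by fun_prop)
  rw [indepFun_iff_map_prod_eq_prod_map_map hW'.aemeasurable (h.measurable_X _).aemeasurable,
    hy] at hi
  -- Trades the earlier state for `σ • y` with `σ` of law `ν`, independent of the block.
  have hmap := Measure.map_prod_map (P.map fun ω => (noiseProd N k n ω, φ ω)) ν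
    (f := id) (g := fun σ : T => σ • y) measurable_id (by fun_prop)
  rw [Measure.map_id] at hmap
  have hF : Measurable fun p : (T × ℝ) × S => edist (g (p.1.1 • p.2)) p.1.2 := by
    have : Measurable fun p : (T × ℝ) × S => p.1.1 • p.2 :=
      (continuous_smul (M := T) (X := S)).measurable.comp
        ((measurable_fst.comp measurable_fst).prodMk measurable_snd)
    exact (hg.comp this).edist (by fun_prop)
  calc ∫⁻ ω, edist (g (X k ω)) (φ ω) ∂P
      = ∫⁻ ω, edist (g (noiseProd N k n ω • X (k + n + 1) ω)) (φ ω) ∂P := by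
        refine lintegral_congr_ae ?_
        filter_upwards [h.eq_noiseProd_smul k n] with ω hω
        rw [← hω]
    _ = ∫⁻ p, edist (g (p.1.1 • p.2)) p.1.2
          ∂P.map (fun ω => ((noiseProd N k n ω, φ ω), X (k + n + 1) ω)) :=
        (lintegral_map hF (hW'.prodMk (h.measurable_X _))).symm
    _ = _ := by
        rw [hi, hmap, lintegral_map hF (by fun_prop)]
        simp only [Prod.map, id, mul_smul]

/-- Triangle inequality through `φ`: each of the two terms equals the error of `φ` by
`lintegral_edist`, whence the factor 2. The left side is free of `n` and `φ`. -/
theorem IsSolution.lintegral_edist_smul_le [TopologicalSpace.PseudoMetrizableSpace T]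
    (h : IsSolution μ P X N) (hν : ∀ k, Tendsto (convProd μ k) atTop (𝓝 (ν k))) {x y : S}
    (hx : ∀ k, P.map (X k) = (ν k : Measure T).map (fun σ => σ • x))
    (hy : ∀ k, P.map (X k) = (ν k : Measure T).map (fun σ => σ • y)) (k n : ℕ) {g : S → ℝ}
    (hg : Measurable g) {φ : Ω → ℝ} (hφ : Measurable[noiseFiltration N h.measurable_N k n] φ) :
    ∫⁻ σ, edist (g (σ • x)) (g (σ • y)) ∂(ν k : Measure T) ≤
      2 * ∫⁻ ω, edist (g (X k ω)) (φ ω) ∂P := by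
  have hW' := ((measurable_noiseProd_noiseFiltration h.measurable_N k (le_refl n)).prodMk
    hφ).mono ((noiseFiltration N _ k).le n) le_rfl
  have : IsProbabilityMeasure (P.map fun ω => (noiseProd N k n ω, φ ω)) :=
    Measure.isProbabilityMeasure_map hW'.aemeasurable
  have hfst : (P.map fun ω => (noiseProd N k n ω, φ ω)).map Prod.fst = convProd μ k n := by
    rw [Measure.map_map measurable_fst hW', ← h.map_noiseProd k n]
    rfl
  have hlaw : ((P.map fun ω => (noiseProd N k n ω, φ ω)).prod (ν (k + n + 1) : Measure T)).map
      (fun p => p.1.1 * p.2) = ν k := by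
    have hmap := Measure.map_prod_map (P.map fun ω => (noiseProd N k n ω, φ ω))
      (ν (k + n + 1) : Measure T) (f := Prod.fst) (g := id) measurable_fst measurable_id
    rw [Measure.map_id, hfst] at hmap
    rw [← conv_convProd_limit hν k n, coe_conv, hmap, Measure.map_map (by fun_prop) (by fun_prop)]
    rfl
  have hm : ∀ z : S, Measurable fun σ : T => g (σ • z) := fun z => hg.comp (by fun_prop)
  calc ∫⁻ σ, edist (g (σ • x)) (g (σ • y)) ∂(ν k : Measure T)
      = ∫⁻ p, edist (g ((p.1.1 * p.2) • x)) (g ((p.1.1 * p.2) • y))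
          ∂(P.map (fun ω => (noiseProd N k n ω, φ ω))).prod (ν (k + n + 1) : Measure T) := by
        rw [← hlaw, lintegral_map ((hm x).edist (hm y)) (by fun_prop)]
    _ ≤ ∫⁻ p, (edist (g ((p.1.1 * p.2) • x)) p.1.2 + edist (g ((p.1.1 * p.2) • y)) p.1.2)
          ∂(P.map (fun ω => (noiseProd N k n ω, φ ω))).prod (ν (k + n + 1) : Measure T) :=
        lintegral_mono fun p => edist_triangle_right _ _ _
    _ = _ := by
        rw [lintegral_add_left, ← h.lintegral_edist k n hg hφ (hx _),
          ← h.lintegral_edist k n hg hφ (hy _), two_mul]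
        exact ((hm x).comp (g := fun σ => g (σ • x)) (f := fun p : (T × ℝ) × T => p.1.1 * p.2)
          (by fun_prop)).edist (by fun_prop)

/-- If a strong solution has one-dimensional laws represented by both `x` and `y`, then almost
every element for the limit law takes `x` and `y` to the same point. -/
theorem IsSolution.ae_smul_eq_of_isStrong [TopologicalSpace.PseudoMetrizableSpace T]
    [StandardBorelSpace S]
    (h : IsSolution μ P X N) (hν : ∀ k, Tendsto (convProd μ k) atTop (𝓝 (ν k))) {x y : S}
    (hx : ∀ k, P.map (X k) = (ν k : Measure T).map (fun σ => σ • x))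
    (hy : ∀ k, P.map (X k) = (ν k : Measure T).map (fun σ => σ • y))
    (hstrong : IsStrong P X N) (k : ℕ) :
    ∀ᵐ σ ∂(ν k : Measure T), σ • x = σ • y := by
  obtain ⟨f, hf, hXf⟩ := hstrong k
  -- A bounded injective real coordinate on `S`: bounded so that conditional expectations apply,
  -- injective so that equality in `S` can be read off at the end.
  set g : S → ℝ := fun s => Real.arctan (embeddingReal S s) with hg_def
  have hg : Measurable g := Real.measurable_arctan.comp (measurable_embeddingReal S)
  have hginj : Function.Injective g :=
    Real.arctan_injective.comp (measurableEmbedding_embeddingReal S).injective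
  set ψ : Ω → ℝ := fun ω => g (f fun j => N (k + j) ω) with hψ_def
  have hψ : Measurable[⨆ n, noiseFiltration N h.measurable_N k n] ψ := by
    refine (hg.comp hf).comp ?_
    refine @measurable_pi_lambda _ _ _ (⨆ n, noiseFiltration N h.measurable_N k n) _ _ fun j => ?_
    exact (measurable_noise_noiseFiltration h.measurable_N k (le_refl j)).mono
      (le_iSup (fun n => (noiseFiltration N h.measurable_N k n)) j) le_rfl
  have hψ' : Measurable ψ :=
    hψ.mono (iSup_le fun n => (noiseFiltration N h.measurable_N k).le n) le_rfl
  have hψint : Integrable ψ P := by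
    refine Integrable.of_bound hψ'.aestronglyMeasurable (Real.pi / 2) (.of_forall fun ω => ?_)
    rw [Real.norm_eq_abs, abs_le]
    exact ⟨(Real.neg_pi_div_two_lt_arctan _).le, (Real.arctan_lt_pi_div_two _).le⟩
  -- Lévy's upward theorem: the conditional expectations on finite blocks serve as `φ` and converge
  -- to `ψ` in mean.
  have hlim := hψint.tendsto_eLpNorm_condExp (ℱ := noiseFiltration N h.measurable_N k)
    hψ.stronglyMeasurable
  have hbound : ∀ n, ∫⁻ σ, edist (g (σ • x)) (g (σ • y)) ∂(ν k : Measure T) ≤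
      2 * eLpNorm (P[ψ | noiseFiltration N h.measurable_N k n] - ψ) 1 P := fun n => by
    refine (h.lintegral_edist_smul_le hν hx hy k n hg
      (stronglyMeasurable_condExp (m := noiseFiltration N h.measurable_N k n)
        (f := ψ) (μ := P)).measurable).trans_eq ?_
    rw [eLpNorm_one_eq_lintegral_enorm]
    congr 1
    refine lintegral_congr_ae ?_
    filter_upwards [hXf] with ω hω
    rw [edist_comm, edist_eq_enorm_sub, hω]
    rfl
  have hzero : ∫⁻ σ, edist (g (σ • x)) (g (σ • y)) ∂(ν k : Measure T) = 0 := by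
    have h₂ := ENNReal.Tendsto.const_mul (a := 2) hlim (.inr (by simp))
    rw [mul_zero] at h₂
    exact le_antisymm (ge_of_tendsto' h₂ hbound) zero_le
  have hm : ∀ z : S, Measurable fun σ : T => g (σ • z) := fun z => hg.comp (by fun_prop)
  rw [lintegral_eq_zero_iff ((hm x).edist (hm y))] at hzero
  filter_upwards [hzero] with σ hσ
  exact hginj (edist_eq_zero.1 hσ)

omit [TopologicalSpace S] [SecondCountableTopology S] [BorelSpace S] [ContinuousSMul T S] in
/-- Under condition (P2') the limit law of the noise products is right `H`-invariant. -/
theorem ConditionP2'.map_mul_right [TopologicalSpace.PseudoMetrizableSpace T] {H : Set T}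
    (hP : ConditionP2' P N H) (h : IsSolution μ P X N)
    (hν : ∀ k, Tendsto (convProd μ k) atTop (𝓝 (ν k))) (k : ℕ) {b : T} (hb : b ∈ H) :
    (ν k : Measure T).map (fun σ => σ * b) = ν k := by
  obtain ⟨ρ, hρ, hinv⟩ := hP.tendsto_law k
  have h₁ := hρ.tendsto
  simp only [h.map_noiseProd, Measure.map_id] at h₁
  -- The noise products have laws `convProd μ k n`, so both limits are those of one sequence.
  have : ν k = ρ := tendsto_nhds_unique (hν k) h₁
  rw [this]
  exact hinv b hb

end Action

end Tsirelson

theorem mainTheorem5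
    {T S Ω : Type*}
    [TopologicalSpace T] [CompactSpace T] [TopologicalSpace.MetrizableSpace T]
    [SecondCountableTopology T] [MeasurableSpace T] [BorelSpace T]
    [Semigroup T] [ContinuousMul T]
    [TopologicalSpace S] [CompactSpace S] [TopologicalSpace.MetrizableSpace S]
    [SecondCountableTopology S] [MeasurableSpace S] [BorelSpace S]
    [SemigroupAction T S] [ContinuousSMul T S]
    [MeasurableSpace Ω] (P : Measure Ω) [IsProbabilityMeasure P]
    (μ : ℕ → ProbabilityMeasure T)
    (X : ℕ → Ω → S) (N : ℕ → Ω → T)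
    (hXN : Tsirelson.IsExtremalSolution μ P X N)
    (H : Set T) (hP2' : Tsirelson.ConditionP2' P N H)
    (hT : ∀ σ σ₁ σ₂ : T, σ * σ₁ = σ * σ₂ → σ₁ = σ₂)
    (hS : ∀ σ : T, Tsirelson.HasCancellativeAction S σ)
    (ν : ℕ → ProbabilityMeasure T)
    (hν : ∀ k, Tendsto (Tsirelson.convProd μ k) atTop (𝓝 (ν k)))
    (x : S)
    (hx : ∀ k, P.map (X k) = (Tsirelson.actConv (ν k) (diracProba x) : Measure S))
    (hHx : ¬ ∃ y : S, Tsirelson.orbitOf H x = {y}) :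
    ¬ Tsirelson.IsStrong P X N := by
  have hsol := hXN.1
  intro hstrong
  have hx₁ : ∀ k, P.map (X k) = (ν k : Measure T).map (fun σ => σ • x) := fun k => by
    rw [hx, Tsirelson.coe_actConv_diracProba]
  refine hHx ⟨x, Set.eq_singleton_iff_nonempty_unique_mem.2
    ⟨hP2'.nontrivial.nonempty.image _, ?_⟩⟩
  rintro _ ⟨b, hb, rfl⟩
  have hx₂ : ∀ k, P.map (X k) = (ν k : Measure T).map (fun σ => σ • b • x) := fun k => by
    -- The invariance is inserted on both sides; the last rewrite removes it again on the right.
    rw [hx₁, ← hP2'.map_mul_right hsol hν k hb, Measure.map_map (by fun_prop) (by fun_prop),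
      hP2'.map_mul_right hsol hν k hb]
    simp only [Function.comp_def, mul_smul]
  let := TopologicalSpace.metrizableSpaceMetric S
  have : PolishSpace S := inferInstance
  -- An almost sure property of a probability measure holds at some point, and one `σ` suffices for
  -- cancellation.
  obtain ⟨σ, hσ⟩ := (hsol.ae_smul_eq_of_isStrong hν hx₁ hx₂ hstrong 0).exists
  exact (hS σ _ _ hσ).symm
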